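/- Let $r\ge 0$ and let $\mathcal A=(A,<,c_1,\dots,c_r)$ be an arbitrary fixed structure consisting of a strict linear order $(A,<)$ (finite or infinite, with no assumption on how it is represented and no effectivity assumption of any kind) and finitely many constants $c_1,\dots,c_r\in A$. A datalog program over $\mathcal A$ is a finite set $\Pi$ of rules $$P(\bar x)\leftarrow Q_1(\bar y_1),\dots,Q_m(\bar y_m)\qquad(m\ge 0),$$ where $P,Q_1,\dots,Q_m$ are relation symbols with fixed arities ($0$-ary symbols are admitted) and the entries of the tuples $\bar x,\bar y_1,\dots,\bar y_m$ are variables or constant symbols $c_1,\dots,c_r$; repetitions are allowed, and the variables in $\bar x$ need not occur in the $\bar y_j$. The symbols in the heads of the rules are the IDBs of $\Pi$; the order symbol $<$ is not an IDB, and every relation symbol occurring in $\Pi$ that is not an IDB is $<$. The program is evaluated over $\mathcal A$ in stages: initially all IDBs are empty; at each stage one rule is applied, cycling through the rules in a fixed order, which adds to the relation of its head symbol all tuples obtained from $\bar x$ by an assignment of elements of $A$ to the variables of the rule under which all body atoms hold (with $<$ and the $c_i$ interpreted as in $\mathcal A$, and IDBs as in the previous stage). Let $P_\infty^{\Pi,\mathcal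 A}$ be the union of the relations of the IDB $P$ over all stages. Then the datalog nonemptiness problem over $\mathcal A$ is decidable: there is an algorithm which, given a datalog program $\Pi$ over $\mathcal A$ and an IDB $P$ of $\Pi$, decides whether $P_\infty^{\Pi,\mathcal A}\neq\emptyset$. -/

import Mathlib

namespace Datalog

/-- A relation symbol: `none` is the binary order symbol `<` (the only relation symbol in the
vocabulary of the structures considered), and `some (n, k)` is the `n`-th further relation symbol
of arity `k`. -/
abbrev RelSym : Type := Option (ℕ × ℕ)

/-- The arity of a relation symbol. Arity `0` is admitted. -/
def RelSym.arity : RelSym → ℕ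
  | none => 2
  | some (_, k) => k

/-- A term over `r` constant symbols: `Sum.inl x` is the variable with number `x`,
and `Sum.inr i` is the `i`-th constant symbol. -/
abbrev Term (r : ℕ) : Type := ℕ ⊕ Fin r

/-- An atom: a relation symbol together with its list of arguments. -/
abbrev Atom (r : ℕ) : Type := RelSym × List (Term r)

/-- A rule `head ← body`: the first component is the head atom, the second component is the
(possibly empty) list of the atoms in the body. -/
abbrev Rule (r : ℕ) : Type := Atom r × List (Atom r)

/-- A datalog program: a finite set of rules, listed in some order. -/
abbrev Program (r : ℕ) : Type := List (Rule r)

/-- The number of arguments of an atom is the arity of its relation symbol. -/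
def Atom.WellFormed {r : ℕ} (B : Atom r) : Prop := B.2.length = RelSym.arity B.1

/-- The intensional relation symbols of a program are those in the heads of its rules. -/
def Program.IsIDB {r : ℕ} (prog : Program r) (P : RelSym) : Prop := ∃ ρ ∈ prog, ρ.1.1 = P

/-- `prog` is a datalog program over structures `(A, <, c₁, …, cᵣ)`: all atoms are well formed, the
vocabulary `{<}` contains no intensional symbol of `prog`, and it contains every extensional symbol
of `prog`, that is, every symbol which occurs in `prog` and is not intensional. -/
def Program.IsOver {r : ℕ} (prog : Program r) : Prop :=
  (∀ ρ ∈ prog, Atom.WellFormed ρ.1 ∧ ∀ B ∈ ρ.2, Atom.WellFormed B) ∧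
  ¬ Program.IsIDB prog none ∧
  ∀ ρ ∈ prog, ∀ B ∈ ρ.2, ¬ Program.IsIDB prog B.1 → B.1 = none

/-- An interpretation of the relation symbols by sets of tuples of elements of `A`.
A `k`-tuple is a list of length `k`. -/
abbrev Interp (A : Type*) : Type _ := RelSym → Set (List A)

/-- The value of a term, where the constant symbols are interpreted by `c` and the variables by a
partial assignment `v`. Assignments are partial because only the variables of the rule at hand are
to be given a value, which matters when `A` is empty. -/
def Term.eval {A : Type*} {r : ℕ} (c : Fin r → A) (v : ℕ → Option A) : Term r → Option A
  | Sum.inl x => v x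
  | Sum.inr i => some (c i)

/-- Under the assignment `v`, all arguments of the atom `B` have a value, and these values form
the tuple `b`. -/
def Atom.Matches {A : Type*} {r : ℕ} (c : Fin r → A) (v : ℕ → Option A) (B : Atom r)
    (b : List A) : Prop :=
  B.2.map (Term.eval c v) = b.map some

/-- The application of a rule to an interpretation: to the relation of the head symbol one adds
all tuples `a` for which there are tuples, one for every atom of the body and lying in the current
relation of that atom, which form together with `a` an instantiation of the rule.
All other relations stay as they are. -/
def applyRule {A : Type*} {r : ℕ} (c : Fin r → A) (ρ : Rule r) (I : Interp A) : Interp A :=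
  fun P => I P ∪ {a | ρ.1.1 = P ∧ ∃ v : ℕ → Option A, Atom.Matches c v ρ.1 a ∧
    ∀ B ∈ ρ.2, ∃ b ∈ I B.1, Atom.Matches c v B b}

/-- The initial interpretation: `<` is the order of `A`, every other relation is empty. -/
def initial (A : Type*) [LinearOrder A] : Interp A
  | none => {l | ∃ a b : A, a < b ∧ l = [a, b]}
  | some _ => ∅

/-- The computation of `prog` over `(A, <, c)`: one rule is applied at every stage, cycling through
the rules of `prog` in the order in which they are listed. -/
def stage {A : Type*} [LinearOrder A] {r : ℕ} (c : Fin r → A) (prog : Program r) : ℕ → Interp A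
  | 0 => initial A
  | i + 1 =>
    match prog[i % prog.length]? with
    | none => stage c prog i
    | some ρ => applyRule c ρ (stage c prog i)

/-- The result of the computation: the union of all stages. -/
def result {A : Type*} [LinearOrder A] {r : ℕ} (c : Fin r → A) (prog : Program r) : Interp A :=
  fun P => ⋃ i, stage c prog i P

/-- The datalog nonemptiness problem over `(A, <, c)`, as the set of its yes-instances: pairs of a
datalog program `prog` over this structure and an intensional symbol `P` of `prog` whose relation in the
result of the computation is nonempty. -/
def Nonemptiness {A : Type*} [LinearOrder A] {r : ℕ} (c : Fin r → A) :
    Program r × RelSym → Prop :=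
  fun x => Program.IsOver x.1 ∧ Program.IsIDB x.1 x.2 ∧ (result c x.1 x.2).Nonempty

end Datalog

/-! The algorithm may depend on `A`, and only finitely much information about `A` matters. The
constants cut `A` into finitely many convex pieces. Splitting the finite pieces into points and
recutting at these points leaves a finite sequence of singletons and infinite intervals
(`nonempty_stratification`). The number and order of these strata and the strata of the constants
are finite data, which are hard-wired into the algorithm.

For nonemptiness, an infinite interval behaves like a copy of the rationals. Let `Fill` be the order
obtained from `A` by this replacement. A derivation uses finitely many elements, and it survives
every map that fixes the constants and is strictly increasing on those elements
(`Derives.exists_finset`). Since an infinite order contains chains of every finite length,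
derivations over `Fill` can be moved into `A` (`exists_strictMonoOn`).

The diagram of a tuple records the strata and the order of its entries. For a given program only
finitely many diagrams are relevant, and a least fixed point computation on them, with grid points
as representatives, decides the problem. It is complete because the diagrams of facts derived over
`A` are all reached (`exists_mem_reached`). It is sound because `Fill` is homogeneous: finite
partial isomorphisms extend, so all tuples of `Fill` with a reached diagram are derivable there
(`derives_of_mem_reachedIn`). Derivability of all such tuples can fail in `A` itself, for instance
in a discrete interval, whence the detour through `Fill`. -/

namespace Datalog

/-! ### Derivations -/

/-- The facts which have a derivation by the rules of `prog` over `(A, <, c)`. -/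
inductive Derives {A : Type*} [LinearOrder A] {r : ℕ} (c : Fin r → A) (prog : Program r) :
    RelSym → List A → Prop
  | lt {a b : A} (h : a < b) : Derives c prog none [a, b]
  | rule {ρ : Rule r} (hρ : ρ ∈ prog) (v : ℕ → Option A) {a : List A} (bs : Atom r → List A)
      (hhead : Atom.Matches c v ρ.1 a) (hbody : ∀ B ∈ ρ.2, Atom.Matches c v B (bs B))
      (h : ∀ B ∈ ρ.2, Derives c prog B.1 (bs B)) : Derives c prog ρ.1.1 a

theorem Term.eval_map {A A' : Type*} {r : ℕ} {c : Fin r → A} {c' : Fin r → A'} {f : A' → A}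
    (hf : ∀ i, f (c' i) = c i) (v : ℕ → Option A') (t : Term r) :
    Term.eval c (fun x => (v x).map f) t = (Term.eval c' v t).map f := by
  cases t <;> simp [Term.eval, hf]

theorem Atom.Matches.map {A A' : Type*} {r : ℕ} {c : Fin r → A} {c' : Fin r → A'} {f : A' → A}
    (hf : ∀ i, f (c' i) = c i) {v : ℕ → Option A'} {B : Atom r} {b : List A'}
    (h : Atom.Matches c' v B b) : Atom.Matches c (fun x => (v x).map f) B (b.map f) := by
  have := congrArg (List.map (Option.map f)) h
  simp only [List.map_map, Function.comp_def, ← Term.eval_map hf, Option.map_some] at this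
  simpa only [Atom.Matches, List.map_map, Function.comp_def] using this

section Derives

variable {A : Type*} [LinearOrder A] {r : ℕ} {c : Fin r → A} {prog : Program r}

theorem Derives.of_mem_stage {P : RelSym} {a : List A} {i : ℕ} (h : a ∈ stage c prog i P) :
    Derives c prog P a := by
  induction i generalizing P a with
  | zero =>
    cases P with
    | none =>
      obtain ⟨x, y, hxy, rfl⟩ := h
      exact .lt hxy
    | some p => exact h.elim
  | succ i ih =>
    rcases hρ : prog[i % prog.length]? with _ | ρ <;> rw [stage, hρ] at h
    · exact ih h
    · rcases h with h | ⟨rfl, v, hv, hb⟩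
      · exact ih h
      · choose! bs hbs hm using hb
        exact .rule (List.mem_of_getElem? hρ) v bs hv hm fun B hB => ih (hbs B hB)

theorem stage_subset_succ (i : ℕ) (P : RelSym) : stage c prog i P ⊆ stage c prog (i + 1) P := by
  rcases hρ : prog[i % prog.length]? with _ | ρ <;> rw [stage.eq_2, hρ]
  exact Set.subset_union_left

theorem stage_mono (P : RelSym) : Monotone fun i => stage c prog i P :=
  monotone_nat_of_le_succ fun i => stage_subset_succ i P

theorem Derives.exists_mem_stage {P : RelSym} {a : List A} (h : Derives c prog P a) :
    ∃ i, a ∈ stage c prog i P := by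
  induction h with
  | lt h => exact ⟨0, _, _, h, rfl⟩
  | @rule ρ hρ v a bs hhead hbody _ ih =>
    choose! n hn using ih
    obtain ⟨N, hN⟩ : ∃ N, ∀ B ∈ ρ.2, n B ≤ N := by
      obtain ⟨N, hN⟩ := (ρ.2.map n).toFinset.exists_le
      exact ⟨N, fun B hB => hN _ (by simpa using ⟨B.1, B.2, hB, rfl⟩)⟩
    obtain ⟨j, hj, rfl⟩ := List.mem_iff_getElem.1 hρ
    have hlen : 0 < prog.length := by omega
    have hmod : (N * prog.length + j) % prog.length = j := by
      rw [Nat.mul_comm, Nat.mul_add_mod, Nat.mod_eq_of_lt hj]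
    -- By stage `N` all body facts are present; this is a later stage at which the cycle has come
    -- round to rule `j`.
    refine ⟨N * prog.length + j + 1, ?_⟩
    rw [stage.eq_2, hmod, List.getElem?_eq_getElem hj]
    refine Or.inr ⟨rfl, v, hhead, fun B hB => ⟨bs B, ?_, hbody B hB⟩⟩
    refine stage_mono B.1 ?_ (hn B hB)
    exact (hN B hB).trans ((Nat.le_mul_of_pos_right N hlen).trans (Nat.le_add_right _ _))

theorem mem_result_iff {P : RelSym} {a : List A} :
    a ∈ result c prog P ↔ Derives c prog P a := by
  constructor
  · intro h
    obtain ⟨i, hi⟩ := Set.mem_iUnion.1 h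
    exact .of_mem_stage hi
  · intro h
    exact Set.mem_iUnion.2 h.exists_mem_stage

theorem Derives.exists_lt (hprog : ¬ Program.IsIDB prog none) {a : List A}
    (h : Derives c prog none a) : ∃ x y, x < y ∧ a = [x, y] := by
  generalize hP : (none : RelSym) = P at h
  cases h with
  | lt h => exact ⟨_, _, h, rfl⟩
  | rule hρ => exact (hprog ⟨_, hρ, hP.symm⟩).elim

/-- A derivation involves finitely many elements: it is transported by every map which preserves the
constants and is strictly monotone on a suitable finite set. -/
theorem Derives.exists_finset {A' : Type*} [LinearOrder A'] {c' : Fin r → A'} {P : RelSym}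
    {a : List A'} (h : Derives c' prog P a) :
    ∃ F : Finset A', ∀ f : A' → A, StrictMonoOn f F → (∀ i, f (c' i) = c i) →
      Derives c prog P (a.map f) := by
  induction h with
  | @lt x y h =>
    refine ⟨{x, y}, fun f hf _ => .lt (hf ?_ ?_ h)⟩ <;> simp
  | @rule ρ hρ v a bs hhead hbody _ ih =>
    choose! F hF using ih
    classical
    refine ⟨ρ.2.toFinset.biUnion F, fun f hf hc => ?_⟩
    refine .rule hρ _ (fun B => (bs B).map f) (hhead.map hc)
      (fun B hB => (hbody B hB).map hc) fun B hB => hF B hB f (hf.mono ?_) hc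
    exact_mod_cast Finset.subset_biUnion_of_mem F (List.mem_toFinset.2 hB)

end Derives

/-! ### Stratifications of a linear order with constants -/

/-- A monotone map of `A` to finitely many levels, all of whose nonempty fibres are singletons or
infinite, where the fibres of the constants are singletons. -/
structure Stratification {A : Type*} [LinearOrder A] {r : ℕ} (c : Fin r → A) where
  /-- The level of an element. -/
  level : A → ℕ
  mono : Monotone level
  /-- The levels with exactly one element. -/
  singletons : List ℕ
  /-- The levels with infinitely many elements. -/
  intervals : List ℕ
  level_mem : ∀ a, level a ∈ singletons ∨ level a ∈ intervals
  exists_level_eq : ∀ n ∈ singletons, ∃ a, level a = n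
  eq_of_level_eq : ∀ a b, level a ∈ singletons → level a = level b → a = b
  infinite : ∀ n ∈ intervals, {a | level a = n}.Infinite
  level_const : ∀ i, level (c i) ∈ singletons

/-- The position of `a` relative to the elements of a finite set. -/
def position {A : Type*} [LinearOrder A] (K : Finset A) (a : A) : ℕ :=
  (K.filter (· < a)).card + (K.filter (· ≤ a)).card

section position

variable {A : Type*} [LinearOrder A] {K : Finset A}

theorem position_mono : Monotone (position K) := fun a b h => by
  unfold position
  gcongr

theorem position_le (a : A) : position K a ≤ K.card + K.card :=
  add_le_add (Finset.card_filter_le _ _) (Finset.card_filter_le _ _)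

theorem finite_range_position : (Set.range (position K)).Finite :=
  (Set.finite_Iic (K.card + K.card)).subset (by rintro _ ⟨a, rfl⟩; exact position_le a)

theorem position_lt_of_mem_Ico {a b k : A} (hk : k ∈ K) (h1 : a ≤ k) (h2 : k < b) :
    position K a < position K b := by
  refine add_lt_add_of_lt_of_le (Finset.card_lt_card ?_) (Finset.card_le_card ?_)
  · refine Finset.ssubset_iff_of_subset (fun x hx => ?_) |>.2 ⟨k, ?_, ?_⟩
    · simp only [Finset.mem_filter] at hx ⊢
      exact ⟨hx.1, hx.2.trans (h1.trans_lt h2)⟩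
    · simp [hk, h2]
    · simp [h1]
  · intro x hx
    simp only [Finset.mem_filter] at hx ⊢
    exact ⟨hx.1, hx.2.trans (h1.trans_lt h2).le⟩

theorem position_lt_of_mem_Ioc {a b k : A} (hk : k ∈ K) (h1 : a < k) (h2 : k ≤ b) :
    position K a < position K b := by
  refine add_lt_add_of_le_of_lt (Finset.card_le_card ?_) (Finset.card_lt_card ?_)
  · intro x hx
    simp only [Finset.mem_filter] at hx ⊢
    exact ⟨hx.1, hx.2.trans (h1.trans_le h2)⟩
  · refine Finset.ssubset_iff_of_subset (fun x hx => ?_) |>.2 ⟨k, ?_, ?_⟩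
    · simp only [Finset.mem_filter] at hx ⊢
      exact ⟨hx.1, hx.2.trans (h1.trans_le h2).le⟩
    · simp [hk, h2]
    · simp [h1]

/-- Counting with both `<` and `≤` gives the elements of `K` the odd positions and the gaps between
them the even ones. -/
theorem eq_of_position_eq {a b : A} (ha : a ∈ K) (h : position K a = position K b) : a = b := by
  rcases lt_trichotomy a b with hab | hab | hab
  · exact absurd h (position_lt_of_mem_Ico ha le_rfl hab).ne
  · exact hab
  · exact absurd h.symm (position_lt_of_mem_Ioc ha hab le_rfl).ne

theorem position_eq_of_forall_lt_iff {a b : A} (h : ∀ k ∈ K, k < a ↔ k < b)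
    (h' : ∀ k ∈ K, k ≤ a ↔ k ≤ b) : position K a = position K b := by
  unfold position
  rw [Finset.filter_congr h, Finset.filter_congr h']

end position

/-- Let `K` collect the elements whose position relative to the constants is shared by finitely many
elements only. There are finitely many positions, so `K` is finite, and it contains the constants.
Cutting at `K` leaves the infinite pieces intact. -/
theorem nonempty_stratification {A : Type*} [LinearOrder A] {r : ℕ} (c : Fin r → A) :
    Nonempty (Stratification c) := by
  classical
  set C : Finset A := Finset.univ.image c
  have hKfin : {a | {b | position C b = position C a}.Finite}.Finite := by
    have : {a | {b | position C b = position C a}.Finite} ⊆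
        ⋃ n ∈ {n ∈ Set.range (position C) | {b | position C b = n}.Finite},
          {b | position C b = n} := by
      intro a ha
      simp only [Set.mem_iUnion]
      exact ⟨position C a, ⟨⟨a, rfl⟩, ha⟩, rfl⟩
    exact (Set.Finite.biUnion (finite_range_position.subset fun n hn => hn.1)
      fun n hn => hn.2).subset this
  set K : Finset A := hKfin.toFinset
  have hK : ∀ a, a ∈ K ↔ {b | position C b = position C a}.Finite := by simp [K]
  have hsub : ∀ a, a ∉ K → {b | position C b = position C a} ⊆
      {b | position K b = position K a} := by
    intro a ha b hb
    have hb : position C b = position C a := hb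
    -- A class of `position C` lies inside `K` or misses it. Classes are convex, so no element of
    -- `K` separates two members of a class that misses `K`.
    have key : ∀ k ∈ K, position C k ≠ position C a := by
      intro k hk h
      rw [hK] at hk ha
      rw [h] at hk
      exact ha hk
    have h1 : ∀ k ∈ K, ¬ (a ≤ k ∧ k ≤ b) := fun k hk h =>
      key k hk (le_antisymm (hb ▸ position_mono h.2) (position_mono h.1))
    have h2 : ∀ k ∈ K, ¬ (b ≤ k ∧ k ≤ a) := fun k hk h =>
      key k hk (le_antisymm (position_mono h.2) (hb ▸ position_mono h.1))
    refine position_eq_of_forall_lt_iff (fun k hk => ?_) fun k hk => ?_ <;>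
    · have := h1 k hk
      have := h2 k hk
      grind
  have himg : ((position K) '' (K : Set A)).Finite := K.finite_toSet.image _
  have hcompl : ((position K) '' (K : Set A)ᶜ).Finite :=
    finite_range_position.subset (Set.image_subset_range _ _)
  refine ⟨⟨position K, position_mono, himg.toFinset.toList, hcompl.toFinset.toList,
    fun a => ?_, fun n hn => ?_, fun a b ha hab => ?_, fun n hn => ?_, fun i => ?_⟩⟩
  · by_cases ha : a ∈ K
    · left
      simpa using ⟨a, ha, rfl⟩
    · right
      simpa using ⟨a, ha, rfl⟩
  · simp only [Finset.mem_toList, Set.Finite.mem_toFinset] at hn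
    obtain ⟨a, -, rfl⟩ := hn
    exact ⟨a, rfl⟩
  · simp only [Finset.mem_toList, Set.Finite.mem_toFinset] at ha
    obtain ⟨k, hk, hka⟩ := ha
    have hk : k ∈ K := hk
    rw [← eq_of_position_eq hk hka, ← eq_of_position_eq hk (hka.trans hab)]
  · simp only [Finset.mem_toList, Set.Finite.mem_toFinset] at hn
    obtain ⟨a, ha, rfl⟩ := hn
    have ha : a ∉ K := ha
    have hinf : {b | position C b = position C a}.Infinite := fun h => ha ((hK a).2 h)
    exact hinf.mono (hsub a ha)
  · have hc : c i ∈ K := by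
      rw [hK]
      refine (Set.finite_singleton (c i)).subset fun b hb => ?_
      exact (eq_of_position_eq (K := C) (by simp [C]) (Eq.symm hb)).symm
    simpa using ⟨c i, hc, rfl⟩

/-! ### Diagrams of tuples -/

/-- A set with a level for each of its elements and a decidable relation. -/
structure Leveled (X : Type*) where
  /-- The level of an element. -/
  level : X → ℕ
  /-- The relation. -/
  lt : X → X → Bool

/-- The levels of the entries of a tuple, and the table of the relation between its entries. -/
def Leveled.diagram {X : Type*} (𝒳 : Leveled X) (l : List (Option X)) :
    List (Option ℕ) × List (List Bool) :=
  (l.map (Option.map 𝒳.level),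
    l.map fun o => l.map fun o' => o.elim false fun x => o'.elim false fun y => 𝒳.lt x y)

/-- A linear order with a level for each of its elements. -/
def Leveled.ofOrder {X : Type*} [LinearOrder X] (level : X → ℕ) : Leveled X :=
  ⟨level, fun x y => decide (x < y)⟩

/-- A set of pairs which preserves levels and the relation. -/
structure IsPartialIso {X Y : Type*} (𝒳 : Leveled X) (𝒴 : Leveled Y) (T : Set (X × Y)) : Prop where
  level : ∀ p ∈ T, 𝒳.level p.1 = 𝒴.level p.2
  lt : ∀ p ∈ T, ∀ q ∈ T, 𝒳.lt p.1 q.1 = 𝒴.lt p.2 q.2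

section Diagram

variable {X Y : Type*} {𝒳 : Leveled X} {𝒴 : Leveled Y} {T : Set (X × Y)}

theorem map_eq_map_of_forall₂ {α β γ : Type*} {R : α → β → Prop} {f : α → γ} {g : β → γ}
    (hR : ∀ x y, R x y → f x = g y) {l : List α} {l' : List β} (h : List.Forall₂ R l l') :
    l.map f = l'.map g := by
  induction h with
  | nil => rfl
  | cons h _ ih => simp [hR _ _ h, ih]

theorem IsPartialIso.diagram_eq (hT : IsPartialIso 𝒳 𝒴 T) {l : List (Option X)}
    {l' : List (Option Y)} (h : List.Forall₂ (Option.Rel fun x y => (x, y) ∈ T) l l') :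
    𝒳.diagram l = 𝒴.diagram l' := by
  refine Prod.ext (map_eq_map_of_forall₂ ?_ h) (map_eq_map_of_forall₂ ?_ h)
  · rintro _ _ (hxy | _)
    · simpa using hT.level _ hxy
    · rfl
  · rintro _ _ (hxy | _) <;> refine map_eq_map_of_forall₂ ?_ h
    · rintro _ _ (hxy' | _)
      · simpa using hT.lt _ hxy _ hxy'
      · rfl
    · rintro _ _ _
      rfl

theorem isPartialIso_of_diagram_eq {l : List (Option X)} {l' : List (Option Y)}
    (h : 𝒳.diagram l = 𝒴.diagram l') :
    IsPartialIso 𝒳 𝒴 {p | (some p.1, some p.2) ∈ l.zip l'} := by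
  obtain ⟨h1, h2⟩ := Prod.ext_iff.1 h
  simp only [Leveled.diagram] at h1 h2
  constructor
  · rintro ⟨x, y⟩ hp
    obtain ⟨i, hi⟩ := List.mem_iff_getElem?.1 hp
    rw [List.getElem?_zip_eq_some] at hi
    have := congrArg (·[i]?) h1
    simpa [hi] using this
  · rintro ⟨x, y⟩ hp ⟨x', y'⟩ hq
    obtain ⟨i, hi⟩ := List.mem_iff_getElem?.1 hp
    obtain ⟨j, hj⟩ := List.mem_iff_getElem?.1 hq
    rw [List.getElem?_zip_eq_some] at hi hj
    have := congrArg (·[i]?) h2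
    simp only [List.getElem?_map, hi, Option.map_some, Option.some.injEq] at this
    have := congrArg (·[j]?) this
    simpa [hj] using this

theorem none_mem_iff_of_diagram_eq {l : List (Option X)} {l' : List (Option Y)}
    (h : 𝒳.diagram l = 𝒴.diagram l') : none ∈ l ↔ none ∈ l' := by
  have : none ∈ (𝒳.diagram l).1 ↔ none ∈ (𝒴.diagram l').1 := by rw [h]
  simpa [Leveled.diagram] using this

theorem length_eq_of_diagram_eq {l : List (Option X)} {l' : List (Option Y)}
    (h : 𝒳.diagram l = 𝒴.diagram l') : l.length = l'.length := by
  simpa [Leveled.diagram] using congrArg (fun d => d.1.length) h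

theorem exists_eq_map_some {α : Type*} {l : List (Option α)} (h : none ∉ l) :
    ∃ a : List α, l = a.map some := by
  induction l with
  | nil => exact ⟨[], rfl⟩
  | cons o l ih =>
    simp only [List.mem_cons, not_or] at h
    obtain ⟨a, rfl⟩ := ih h.2
    obtain ⟨x, rfl⟩ := Option.ne_none_iff_exists'.1 (Ne.symm h.1)
    exact ⟨x :: a, rfl⟩

/-- The table of a pair whose entries are related from left to right only. -/
def ltTable : List (List Bool) := [[false, true], [false, false]]

/-- Undefined entries produce only `false`, so the single `true` forces both entries to be defined.
-/
theorem exists_lt_of_diagram_eq_ltTable {l : List (Option X)} (h : (𝒳.diagram l).2 = ltTable) :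
    ∃ x y, 𝒳.lt x y ∧ l = [some x, some y] := by
  have hlen : l.length = 2 := by simpa [Leveled.diagram, ltTable] using congrArg List.length h
  obtain ⟨o, o', rfl⟩ := List.length_eq_two.1 hlen
  rcases o with _ | x <;> rcases o' with _ | y <;> simp [Leveled.diagram, ltTable] at h
  exact ⟨x, y, h.1.2, rfl⟩

theorem diagram_eq_ltTable [LinearOrder X] {level : X → ℕ} {x y : X} (h : x < y) :
    ((Leveled.ofOrder level).diagram [some x, some y]).2 = ltTable := by
  simp [Leveled.diagram, ltTable, Leveled.ofOrder, h, h.le]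

theorem IsPartialIso.insert_pair {x : X} {y : Y} (hT : IsPartialIso 𝒳 𝒴 T)
    (hlevel : 𝒳.level x = 𝒴.level y) (hxy : 𝒳.lt x x = 𝒴.lt y y)
    (h : ∀ p ∈ T, 𝒳.lt x p.1 = 𝒴.lt y p.2 ∧ 𝒳.lt p.1 x = 𝒴.lt p.2 y) :
    IsPartialIso 𝒳 𝒴 (insert (x, y) T) := by
  constructor
  · rintro p (rfl | hp)
    exacts [hlevel, hT.level p hp]
  · rintro p (rfl | hp) q (rfl | hq)
    exacts [hxy, (h q hq).1, (h p hp).2, hT.lt p hp q hq]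

/-- Terms take corresponding values under corresponding assignments. -/
theorem forall₂_eval {r : ℕ} {c : Fin r → X} {d : Fin r → Y} {v : ℕ → Option X}
    {w : ℕ → Option Y} {R : X → Y → Prop} (hc : ∀ i, R (c i) (d i)) {l : List (Term r)}
    (hv : ∀ x, Sum.inl x ∈ l → Option.Rel R (v x) (w x)) :
    List.Forall₂ (Option.Rel R) (l.map (Term.eval c v)) (l.map (Term.eval d w)) := by
  rw [List.forall₂_map_left_iff, List.forall₂_map_right_iff, List.forall₂_same]
  rintro (x | i) ht
  · exact hv x ht
  · exact .some (hc i)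

end Diagram

/-! ### The grid and the order with dense strata -/

/-- The points of a grid, ordered lexicographically, where the level is the first coordinate. -/
def grid : Leveled (ℕ × ℕ) := ⟨Prod.fst, fun p q => decide (p.1 < q.1 ∨ p.1 = q.1 ∧ p.2 < q.2)⟩

/-- The points of the grid on the level of a singleton or an interval. -/
def IsGridPoint (sg iv : List ℕ) (p : ℕ × ℕ) : Prop := p.1 ∈ sg ∧ p.2 = 0 ∨ p.1 ∈ iv

/-- The linear order with one element on each of the levels in `sg` and a copy of the rational
numbers on each of the levels in `iv`. -/
abbrev Fill (sg iv : List ℕ) : Type :=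
  {p : ℕ ×ₗ ℚ // (ofLex p).1 ∈ sg ∧ (ofLex p).2 = 0 ∨ (ofLex p).1 ∈ iv}

/-- The level of an element. -/
def Fill.level {sg iv : List ℕ} (y : Fill sg iv) : ℕ := (ofLex y.1).1

/-- The rational coordinate of an element. -/
def Fill.coord {sg iv : List ℕ} (y : Fill sg iv) : ℚ := (ofLex y.1).2

/-- The element with coordinate `0` on the level of a singleton. -/
def Fill.single {sg : List ℕ} (iv : List ℕ) (n : ℕ) (hn : n ∈ sg) : Fill sg iv :=
  ⟨toLex (n, 0), .inl ⟨hn, rfl⟩⟩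

section Fill

variable {sg iv : List ℕ}

theorem Fill.lt_iff {y z : Fill sg iv} :
    y < z ↔ y.level < z.level ∨ y.level = z.level ∧ y.coord < z.coord :=
  Subtype.coe_lt_coe.symm.trans Prod.Lex.lt_iff

theorem Fill.ext {y z : Fill sg iv} (h : y.level = z.level) (h' : y.coord = z.coord) : y = z :=
  Subtype.ext (Prod.ext h h')

theorem Fill.coord_eq_zero (hd : ∀ n ∈ sg, n ∉ iv) {y : Fill sg iv} (hy : y.level ∈ sg) :
    y.coord = 0 := by
  rcases y.2 with h | h
  · exact h.2
  · exact (hd _ hy h).elim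

/-- The grid relation is irreflexive, so neither image of `x` lies below the other. -/
theorem IsPartialIso.right_unique {T : Set ((ℕ × ℕ) × Fill sg iv)}
    (hT : IsPartialIso grid (.ofOrder Fill.level) T) {x : ℕ × ℕ} {y z : Fill sg iv}
    (hy : (x, y) ∈ T) (hz : (x, z) ∈ T) : y = z := by
  have h1 := hT.lt _ hy _ hz
  have h2 := hT.lt _ hz _ hy
  simp only [grid, Leveled.ofOrder, lt_self_iff_false, and_false, or_self, decide_false] at h1 h2
  exact le_antisymm (by simpa using h2.symm) (by simpa using h1.symm)

/-- The forth step of Cantor's argument. On an interval level, density of the rationals and absence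
of endpoints provide a coordinate between the finitely many images from below and from above. On a
singleton level the grid has only the point `x`, so no constraint arises. -/
theorem IsPartialIso.exists_insert (hd : ∀ n ∈ sg, n ∉ iv) {T : Set ((ℕ × ℕ) × Fill sg iv)}
    (hT : IsPartialIso grid (.ofOrder Fill.level) T) (hfin : T.Finite)
    (hgrid : ∀ p ∈ T, IsGridPoint sg iv p.1) {x : ℕ × ℕ} (hx : IsGridPoint sg iv x) :
    ∃ y, IsPartialIso grid (.ofOrder Fill.level) (insert (x, y) T) := by
  by_cases hxT : ∃ y, (x, y) ∈ T
  · obtain ⟨y, hy⟩ := hxT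
    exact ⟨y, by rwa [Set.insert_eq_of_mem hy]⟩
  have key : ∃ y : Fill sg iv, y.level = x.1 ∧ ∀ p ∈ T, p.1.1 = x.1 →
      (p.1.2 < x.2 ∧ p.2.coord < y.coord) ∨ (x.2 < p.1.2 ∧ y.coord < p.2.coord) := by
    have hne : ∀ p ∈ T, p.1.1 = x.1 → p.1.2 ≠ x.2 := fun p hp h1 h2 =>
      hxT ⟨p.2, by rwa [← Prod.ext h1 h2]⟩
    rcases hx with hx | hx
    · refine ⟨Fill.single iv x.1 hx.1, rfl, fun p hp h => (hne p hp h ?_).elim⟩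
      rcases hgrid p hp with h' | h'
      · rw [h'.2, hx.2]
      · exact (hd _ hx.1 (h ▸ h')).elim
    · classical
      set lo := (hfin.toFinset.filter fun p => p.1.1 = x.1 ∧ p.1.2 < x.2).image fun p => p.2.coord
      set hi := (hfin.toFinset.filter fun p => p.1.1 = x.1 ∧ x.2 < p.1.2).image fun p => p.2.coord
      obtain ⟨q, hlo, hhi⟩ := Order.exists_between_finsets lo hi (by
        intro a ha b hb
        simp only [lo, hi, Finset.mem_image, Finset.mem_filter, Set.Finite.mem_toFinset] at ha hb
        obtain ⟨p, ⟨hp, hp1, hp2⟩, rfl⟩ := ha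
        obtain ⟨p', ⟨hp', hp1', hp2'⟩, rfl⟩ := hb
        have h1 := hT.lt p hp p' hp'
        have h2 := hT.level p hp
        have h3 := hT.level p' hp'
        simp only [grid, Leveled.ofOrder] at h1 h2 h3
        have : p.2 < p'.2 := by
          rw [← decide_eq_true_iff (p := p.2 < p'.2), ← h1]
          simp only [decide_eq_true_eq]
          omega
        rcases Fill.lt_iff.1 this with h | h
        · omega
        · exact h.2)
      refine ⟨⟨toLex (x.1, q), .inr hx⟩, rfl, fun p hp h => ?_⟩
      rcases (hne p hp h).lt_or_gt with h' | h'
      · refine .inl ⟨h', hlo _ ?_⟩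
        simp only [lo, Finset.mem_image, Finset.mem_filter, Set.Finite.mem_toFinset]
        exact ⟨p, ⟨hp, h, h'⟩, rfl⟩
      · refine .inr ⟨h', hhi _ ?_⟩
        simp only [hi, Finset.mem_image, Finset.mem_filter, Set.Finite.mem_toFinset]
        exact ⟨p, ⟨hp, h, h'⟩, rfl⟩
  obtain ⟨y, hy, h⟩ := key
  refine ⟨y, hT.insert_pair hy.symm (by simp [grid, Leveled.ofOrder]) fun p hp => ?_⟩
  have hlev : p.1.1 = p.2.level := hT.level p hp
  have := h p hp
  simp only [grid, Leveled.ofOrder, decide_eq_decide, Fill.lt_iff, ← hlev, hy]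
  rcases lt_trichotomy p.1.1 x.1 with h1 | h1 | h1
  · constructor <;> constructor <;> intro h <;> omega
  · rcases this h1 with ⟨h2, h3⟩ | ⟨h2, h3⟩ <;> simp [h1, h2, h3, h2.not_gt, h3.not_gt]
  · constructor <;> constructor <;> intro h <;> omega

theorem IsPartialIso.exists_superset (hd : ∀ n ∈ sg, n ∉ iv) {T : Set ((ℕ × ℕ) × Fill sg iv)}
    (hT : IsPartialIso grid (.ofOrder Fill.level) T) (hfin : T.Finite)
    (hgrid : ∀ p ∈ T, IsGridPoint sg iv p.1) {l : List (ℕ × ℕ)}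
    (hl : ∀ x ∈ l, IsGridPoint sg iv x) :
    ∃ T', T ⊆ T' ∧ IsPartialIso grid (.ofOrder Fill.level) T' ∧ ∀ x ∈ l, ∃ y, (x, y) ∈ T' := by
  induction l generalizing T with
  | nil => exact ⟨T, subset_rfl, hT, by simp⟩
  | cons x l ih =>
    rw [List.forall_mem_cons] at hl
    obtain ⟨y, hy⟩ := hT.exists_insert hd hfin hgrid hl.1
    obtain ⟨T', hsub, hT', hcov⟩ := ih hy (hfin.insert _) (by
      rintro p (rfl | hp)
      exacts [hl.1, hgrid p hp]) hl.2
    refine ⟨T', (Set.subset_insert _ _).trans hsub, hT', ?_⟩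
    rw [List.forall_mem_cons]
    exact ⟨⟨y, hsub (Set.mem_insert _ _)⟩, hcov⟩

end Fill

/-! ### Comparison of `A` with the dense order and with the grid -/

namespace Stratification

variable {A : Type*} [LinearOrder A] {r : ℕ} {c : Fin r → A} (S : Stratification c)

theorem not_mem_intervals (n : ℕ) (hn : n ∈ S.singletons) : n ∉ S.intervals := by
  intro h
  refine S.infinite n h (Set.Subsingleton.finite fun a ha b hb => ?_)
  have ha : S.level a = n := ha
  exact S.eq_of_level_eq a b (ha ▸ hn) (ha.trans hb.symm)

theorem lt_of_level_lt {a b : A} (h : S.level a < S.level b) : a < b := S.mono.reflect_lt h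

/-- The constants in the order with dense strata. -/
def fillConst (i : Fin r) : Fill S.singletons S.intervals :=
  Fill.single S.intervals (S.level (c i)) (S.level_const i)

/-- Every finite part of the order with dense strata embeds into `A`. -/
theorem exists_strictMonoOn (F : Finset (Fill S.singletons S.intervals)) :
    ∃ f : Fill S.singletons S.intervals → A, StrictMonoOn f F ∧
      ∀ i, f (S.fillConst i) = c i := by
  classical
  have hchain : ∀ n ∈ S.intervals, ∃ g : ℕ → A, StrictMonoOn g (Set.Iio (F.card + 1)) ∧
      ∀ k < F.card + 1, S.level (g k) = n := by
    intro n hn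
    -- The chain is indexed by the number of elements of `F` below a point; the value `F.card` can
    -- occur for points outside `F`.
    obtain ⟨t, ht, hcard⟩ := (S.infinite n hn).exists_subset_card_eq (F.card + 1)
    refine ⟨fun k => t.orderEmbOfFin hcard (Fin.ofNat (F.card + 1) k), fun i hi j hj hij => ?_,
      fun k hk => ht (Finset.orderEmbOfFin_mem t hcard _)⟩
    have hi : i < F.card + 1 := hi
    have hj : j < F.card + 1 := hj
    simp only [OrderEmbedding.lt_iff_lt, Fin.lt_def, Fin.ofNat]
    rwa [Nat.mod_eq_of_lt hi, Nat.mod_eq_of_lt hj]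
  have hA : ∀ y : Fill S.singletons S.intervals, ∃ a, S.level a = y.level := by
    intro y
    rcases y.2 with h | h
    · exact S.exists_level_eq _ h.1
    · exact (S.infinite _ h).nonempty
  choose g hg hlev using hchain
  choose s hs using hA
  let f : Fill S.singletons S.intervals → A := fun y =>
    if h : y.level ∈ S.intervals then g y.level h (F.filter (· < y)).card else s y
  have hcard : ∀ y, (F.filter (· < y)).card < F.card + 1 := fun y =>
    Nat.lt_succ_of_le (Finset.card_filter_le _ _)
  have hf : ∀ y, S.level (f y) = y.level := by
    intro y
    by_cases h : y.level ∈ S.intervals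
    · simp only [f, h, dif_pos]
      exact hlev _ _ _ (hcard y)
    · simp only [f, h, dif_neg, not_false_eq_true]
      exact hs y
  refine ⟨f, fun y hy z hz hyz => ?_, fun i => ?_⟩
  · rcases Fill.lt_iff.1 hyz with h | ⟨h, h'⟩
    · exact S.lt_of_level_lt (by rwa [hf, hf])
    · have hz' : z.level ∈ S.intervals := by
        by_contra hz'
        have h1 := z.2.resolve_right hz'
        have h2 := y.2.resolve_right (by rwa [← h] at hz')
        exact absurd h' (by rw [show y.coord = 0 from h2.2, show z.coord = 0 from h1.2]; simp)
      have hy' : y.level ∈ S.intervals := h ▸ hz'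
      simp only [f, hy', hz', dif_pos]
      have : g y.level hy' = g z.level hz' := by congr
      rw [this]
      refine hg _ _ (hcard y) (hcard z) (Finset.card_lt_card ?_)
      refine Finset.ssubset_iff_of_subset (fun x hx => ?_) |>.2 ⟨y, ?_, ?_⟩
      · simp only [Finset.mem_filter] at hx ⊢
        exact ⟨hx.1, hx.2.trans hyz⟩
      · simpa [hyz] using hy
      · simp
  · refine (S.eq_of_level_eq _ _ (S.level_const i) ?_).symm
    rw [hf]
    rfl

/-- The embedding of a finite subset of `A` and the singleton strata into the grid. -/
def toGrid (F : Finset A) (a : A) : ℕ × ℕ :=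
  (S.level a, if S.level a ∈ S.singletons then 0 else (F.filter (· < a)).card)

theorem grid_lt_toGrid {F : Finset A} {a b : A} (ha : a ∈ F ∨ S.level a ∈ S.singletons)
    (hab : a < b) : grid.lt (S.toGrid F a) (S.toGrid F b) = true := by
  simp only [grid, toGrid, decide_eq_true_eq]
  rcases (S.mono hab.le).lt_or_eq with h | h
  · exact .inl h
  · have hs : S.level a ∉ S.singletons := fun hs => hab.ne (S.eq_of_level_eq a b hs h)
    refine .inr ⟨h, ?_⟩
    rw [if_neg hs, if_neg (h ▸ hs)]
    refine Finset.card_lt_card (Finset.ssubset_iff_of_subset (fun x hx => ?_) |>.2 ⟨a, ?_, ?_⟩)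
    · simp only [Finset.mem_filter] at hx ⊢
      exact ⟨hx.1, hx.2.trans hab⟩
    · simpa [hab] using ha.resolve_right hs
    · simp

/-- The domain includes the singleton strata because constants need not lie in `F`; there the second
coordinate is `0`, which agrees with the grid value of the constants. -/
theorem isPartialIso_toGrid (F : Finset A) :
    IsPartialIso (.ofOrder S.level) grid
      ((fun a => (a, S.toGrid F a)) '' {a | a ∈ F ∨ S.level a ∈ S.singletons}) := by
  constructor
  · rintro _ ⟨a, -, rfl⟩
    rfl
  · rintro _ ⟨a, ha, rfl⟩ _ ⟨b, hb, rfl⟩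
    simp only [Leveled.ofOrder]
    rcases lt_trichotomy a b with h | rfl | h
    · simp [S.grid_lt_toGrid ha h, h]
    · simp [grid]
    · have := S.grid_lt_toGrid hb h
      simp only [grid, decide_eq_true_eq] at this
      simp only [h.not_gt, decide_false, grid, eq_comm (a := false), decide_eq_false_iff_not]
      omega

end Stratification

/-! ### The search for derivations over the grid -/

/-- A partial assignment of grid points to the variables, as a list. -/
abbrev Assignment : Type := List (Option (ℕ × ℕ))

/-- A rule together with an assignment. -/
abbrev Node (r : ℕ) : Type := Rule r × Assignment

/-- The tuple of values of the arguments of an atom over the grid, where `lc` gives the levels of the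
constants. -/
def instTuple {r : ℕ} (lc : Fin r → ℕ) (w : Assignment) (B : Atom r) : List (Option (ℕ × ℕ)) :=
  B.2.map (Term.eval (fun i => (lc i, 0)) fun x => w[x]?.join)

/-- The diagram of the values of the arguments of an atom over the grid. -/
def instDiagram {r : ℕ} (lc : Fin r → ℕ) (w : Assignment) (B : Atom r) :
    List (Option ℕ) × List (List Bool) :=
  grid.diagram (instTuple lc w B)

/-- An atom holds under an assignment, given the nodes reached so far: for the order symbol this is
the order of the grid, and for other symbols the head of a reached node has the same diagram. -/
def AtomHolds {r : ℕ} (lc : Fin r → ℕ) (B : Atom r) (p : Assignment × List (Node r)) : Prop :=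
  (B.1 = none ∧ (instDiagram lc p.1 B).2 = ltTable) ∨
    ∃ y ∈ p.2, y.1.1.1 = B.1 ∧ instDiagram lc y.2 y.1.1 = instDiagram lc p.1 B

/-- A node is enabled by a list of nodes if all body atoms hold and the head has a value. -/
def Enabled {r : ℕ} (lc : Fin r → ℕ) (x : Node r) (l : List (Node r)) : Prop :=
  none ∉ instTuple lc x.2 x.1.1 ∧ ∀ B ∈ x.1.2, AtomHolds lc B (x.2, l)

/-- The lists of length `n` with entries from `l`. -/
def words {α : Type*} (l : List α) : ℕ → List (List α)
  | 0 => [[]]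
  | n + 1 => (words l n).flatMap fun w => l.map fun a => a :: w

/-- The points of the grid with second coordinate less than `N`. -/
def gridPoints (sg iv : List ℕ) (N : ℕ) : List (ℕ × ℕ) :=
  sg.map (fun n => (n, 0)) ++ iv.flatMap fun n => (List.range N).map fun t => (n, t)

/-- A strict upper bound for the variables of a program. -/
def varBound {r : ℕ} (prog : Program r) : ℕ := Encodable.encode prog + 1

/-- The assignments of grid points to the variables of a program. -/
def assignments {r : ℕ} (sg iv : List ℕ) (prog : Program r) : List Assignment :=
  words (none :: (gridPoints sg iv (varBound prog)).map some) (varBound prog)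

/-- All nodes of a program. -/
def nodes {r : ℕ} (sg iv : List ℕ) (prog : Program r) : List (Node r) :=
  prog.flatMap fun ρ => (assignments sg iv prog).map fun w => (ρ, w)

open Classical in
/-- The nodes enabled by a list of nodes. -/
noncomputable def enabledNodes {r : ℕ} (lc : Fin r → ℕ) (sg iv : List ℕ) (prog : Program r)
    (l : List (Node r)) : List (Node r) :=
  (nodes sg iv prog).filter fun x => Enabled lc x l

/-- The nodes which are reached in `n` rounds. -/
noncomputable def reachedIn {r : ℕ} (lc : Fin r → ℕ) (sg iv : List ℕ) (prog : Program r) (n : ℕ) :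
    List (Node r) :=
  (enabledNodes lc sg iv prog)^[n] []

/-- The nodes which are reached eventually. -/
noncomputable def reached {r : ℕ} (lc : Fin r → ℕ) (sg iv : List ℕ) (prog : Program r) :
    List (Node r) :=
  reachedIn lc sg iv prog (nodes sg iv prog).length

section Search

variable {r : ℕ} {lc : Fin r → ℕ} {sg iv : List ℕ} {prog : Program r}

theorem mem_words {α : Type*} {l : List α} {n : ℕ} {w : List α} :
    w ∈ words l n ↔ w.length = n ∧ ∀ a ∈ w, a ∈ l := by
  induction n generalizing w with
  | zero =>
    simp only [words, List.mem_singleton, List.length_eq_zero_iff]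
    constructor
    · rintro rfl
      simp
    · exact fun h => h.1
  | succ n ih =>
    simp only [words, List.mem_flatMap, List.mem_map, ih]
    constructor
    · rintro ⟨w, ⟨rfl, hw⟩, a, ha, rfl⟩
      simpa using ⟨ha, hw⟩
    · rintro ⟨hlen, hw⟩
      cases w with
      | nil => simp at hlen
      | cons a w =>
        simp only [List.mem_cons, forall_eq_or_imp] at hw
        exact ⟨w, ⟨by simpa using hlen, hw.2⟩, a, hw.1, rfl⟩

theorem IsGridPoint.of_mem_gridPoints {N : ℕ} {p : ℕ × ℕ} (h : p ∈ gridPoints sg iv N) :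
    IsGridPoint sg iv p := by
  simp only [gridPoints, List.mem_append, List.mem_map, List.mem_flatMap] at h
  rcases h with ⟨n, hn, rfl⟩ | ⟨n, hn, t, -, rfl⟩
  exacts [.inl ⟨hn, rfl⟩, .inr hn]

theorem mem_nodes {x : Node r} :
    x ∈ nodes sg iv prog ↔ x.1 ∈ prog ∧ x.2 ∈ assignments sg iv prog := by
  obtain ⟨ρ, w⟩ := x
  simp only [nodes, List.mem_flatMap, List.mem_map, Prod.mk.injEq]
  constructor
  · rintro ⟨ρ', hρ, w', hw, rfl, rfl⟩
    exact ⟨hρ, hw⟩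
  · exact fun h => ⟨ρ, h.1, w, h.2, rfl, rfl⟩

theorem AtomHolds.mono {B : Atom r} {w : Assignment} {l l' : List (Node r)} (hl : l ⊆ l')
    (h : AtomHolds lc B (w, l)) : AtomHolds lc B (w, l') :=
  h.imp_right fun ⟨y, hy, h⟩ => ⟨y, hl hy, h⟩

theorem Enabled.mono {x : Node r} {l l' : List (Node r)} (hl : l ⊆ l')
    (h : Enabled lc x l) : Enabled lc x l' :=
  ⟨h.1, fun B hB => (h.2 B hB).mono hl⟩

theorem mem_enabledNodes {x : Node r} {l : List (Node r)} :
    x ∈ enabledNodes lc sg iv prog l ↔ x ∈ nodes sg iv prog ∧ Enabled lc x l := by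
  simp [enabledNodes]

theorem enabledNodes_sublist {l l' : List (Node r)} (hl : l ⊆ l') :
    (enabledNodes lc sg iv prog l).Sublist (enabledNodes lc sg iv prog l') := by
  classical
  refine List.monotone_filter_right _ fun x hx => ?_
  simp only [decide_eq_true_eq] at hx ⊢
  exact hx.mono hl

theorem reachedIn_succ (n : ℕ) : reachedIn lc sg iv prog (n + 1) =
    enabledNodes lc sg iv prog (reachedIn lc sg iv prog n) :=
  Function.iterate_succ_apply' _ _ _

/-- A round recomputes the list instead of adding to it; growth follows from monotonicity of the
operator and the start at `[]`. Sublists of one fixed list can then be compared by length. -/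
theorem reachedIn_sublist_succ (n : ℕ) :
    (reachedIn lc sg iv prog n).Sublist (reachedIn lc sg iv prog (n + 1)) := by
  induction n with
  | zero => exact List.nil_sublist _
  | succ n ih =>
    rw [reachedIn_succ, reachedIn_succ (n + 1)]
    exact enabledNodes_sublist ih.subset

theorem length_reachedIn_le (n : ℕ) :
    (reachedIn lc sg iv prog n).length ≤ (nodes sg iv prog).length := by
  cases n with
  | zero => exact Nat.zero_le _
  | succ n =>
    rw [reachedIn_succ]
    exact List.length_filter_le _ _

theorem le_length_reachedIn_or_eq (n : ℕ) : n ≤ (reachedIn lc sg iv prog n).length ∨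
    reachedIn lc sg iv prog (n + 1) = reachedIn lc sg iv prog n := by
  induction n with
  | zero => exact .inl (Nat.zero_le _)
  | succ n ih =>
    by_cases h : reachedIn lc sg iv prog (n + 1) = reachedIn lc sg iv prog n
    · right
      rw [reachedIn_succ (n + 1), h, ← reachedIn_succ, h]
    · left
      have h1 := ih.resolve_right h
      have h2 := (reachedIn_sublist_succ (lc := lc) (sg := sg) (iv := iv) (prog := prog) n)
      have h3 := h2.length_le
      have h4 : (reachedIn lc sg iv prog n).length ≠ (reachedIn lc sg iv prog (n + 1)).length :=
        fun h' => h (h2.eq_of_length h').symm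
      omega

/-- Each round before stabilization adds a node, so as many rounds as there are nodes suffice. -/
theorem enabledNodes_reached :
    enabledNodes lc sg iv prog (reached lc sg iv prog) = reached lc sg iv prog := by
  rw [reached, ← reachedIn_succ]
  rcases le_length_reachedIn_or_eq (lc := lc) (sg := sg) (iv := iv) (prog := prog)
    (nodes sg iv prog).length with h | h
  · refine ((reachedIn_sublist_succ _).eq_of_length (le_antisymm ?_ ?_)).symm
    · exact (reachedIn_sublist_succ _).length_le
    · exact (length_reachedIn_le _).trans h
  · exact h

theorem mem_reached_of_enabled {x : Node r} (hx : x ∈ nodes sg iv prog)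
    (h : Enabled lc x (reached lc sg iv prog)) : x ∈ reached lc sg iv prog := by
  rw [← enabledNodes_reached]
  exact mem_enabledNodes.2 ⟨hx, h⟩

/-! ### Bounding variables by encodings -/

theorem encode_le_encode_of_mem {α : Type*} [Encodable α] {a : α} {l : List α} (h : a ∈ l) :
    Encodable.encode a ≤ Encodable.encode l := by
  induction l with
  | nil => simp at h
  | cons b l ih =>
    rw [Encodable.encode_list_cons]
    rcases List.mem_cons.1 h with rfl | h
    · exact (Nat.left_le_pair _ _).trans (Nat.le_succ _)
    · exact (ih h).trans ((Nat.right_le_pair _ _).trans (Nat.le_succ _))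

theorem encode_fst_le {α β : Type*} [Encodable α] [Encodable β] (p : α × β) :
    Encodable.encode p.1 ≤ Encodable.encode p := by
  rw [Encodable.encode_prod_val]
  exact Nat.left_le_pair _ _

theorem encode_snd_le {α β : Type*} [Encodable α] [Encodable β] (p : α × β) :
    Encodable.encode p.2 ≤ Encodable.encode p := by
  rw [Encodable.encode_prod_val]
  exact Nat.right_le_pair _ _

theorem lt_varBound {ρ : Rule r} (hρ : ρ ∈ prog) {B : Atom r} (hB : B = ρ.1 ∨ B ∈ ρ.2) {x : ℕ}
    (hx : Sum.inl x ∈ B.2) : x < varBound prog := by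
  have h1 : x ≤ Encodable.encode (Sum.inl x : Term r) := by
    rw [Encodable.encode_inl]
    simp
    omega
  have h2 := encode_le_encode_of_mem hx
  have h3 := encode_snd_le B
  have h4 : Encodable.encode B ≤ Encodable.encode ρ := by
    rcases hB with rfl | hB
    · exact encode_fst_le ρ
    · exact (encode_le_encode_of_mem hB).trans (encode_snd_le ρ)
  exact Nat.lt_succ_of_le (h1.trans (h2.trans (h3.trans (h4.trans (encode_le_encode_of_mem hρ)))))

end Search

/-! ### Completeness of the search -/

namespace Stratification

variable {A : Type*} [LinearOrder A] {r : ℕ} {c : Fin r → A} (S : Stratification c)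
  {prog : Program r}

/-- The nodes reached by the search for the levels of a stratification. -/
noncomputable def reached (prog : Program r) : List (Node r) :=
  Datalog.reached (fun i => S.level (c i)) S.singletons S.intervals prog

theorem toGrid_mem_gridPoints {F : Finset A} {a : A} (ha : a ∈ F) {N : ℕ} (hN : F.card ≤ N) :
    S.toGrid F a ∈ gridPoints S.singletons S.intervals N := by
  simp only [gridPoints, List.mem_append, List.mem_map, List.mem_flatMap, toGrid]
  by_cases hs : S.level a ∈ S.singletons
  · exact .inl ⟨_, hs, by simp [hs]⟩
  · refine .inr ⟨_, (S.level_mem a).resolve_left hs, (F.filter (· < a)).card, ?_, by simp [hs]⟩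
    rw [List.mem_range]
    refine (Finset.card_lt_card ?_).trans_le hN
    exact Finset.filter_ssubset.2 ⟨a, ha, lt_irrefl a⟩

/-- Induction on the derivation: the values of the variables of a rule are moved into the grid by
`toGrid`, which keeps all diagrams. -/
theorem exists_mem_reached (hprog : ¬ Program.IsIDB prog none) {P : RelSym} {a : List A}
    (h : Derives c prog P a) (hP : P ≠ none) :
    ∃ x ∈ S.reached prog, x.1.1.1 = P ∧
      instDiagram (fun i => S.level (c i)) x.2 x.1.1 =
        (Leveled.ofOrder S.level).diagram (a.map some) := by
  induction h with
  | lt => exact (hP rfl).elim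
  | @rule ρ hρ v a bs hhead hbody hder ih =>
    classical
    set N := varBound prog with hN
    -- At most `N` values occur, so their ranks in `F` are below `N` and the grid of width `N`
    -- suffices.
    set F : Finset A := ((List.range N).filterMap v).toFinset with hF
    have hcard : F.card ≤ N := by
      refine (List.toFinset_card_le _).trans ((List.length_filterMap_le _ _).trans ?_)
      simp
    have hvF : ∀ x < N, ∀ y, v x = some y → y ∈ F := fun x hx y hy => by
      simpa [hF] using ⟨x, hx, hy⟩
    set w : Assignment := (List.range N).map fun x => (v x).map (S.toGrid F) with hw
    have hatom : ∀ B : Atom r, (B = ρ.1 ∨ B ∈ ρ.2) → ∀ b, Atom.Matches c v B b →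
        (Leveled.ofOrder S.level).diagram (b.map some) =
          instDiagram (fun i => S.level (c i)) w B := by
      intro B hB b hb
      rw [← hb]
      refine (S.isPartialIso_toGrid F).diagram_eq (forall₂_eval (fun i => ?_) fun x hx => ?_)
      · exact ⟨c i, .inr (S.level_const i), by simp [toGrid, S.level_const i]⟩
      · have hxN : x < N := lt_varBound hρ hB hx
        simp only [hw, List.getElem?_map, List.getElem?_range hxN, Option.map_some,
          Option.join_some]
        rcases hvx : v x with _ | y
        · exact .none
        · exact .some ⟨y, .inl (hvF x hxN y hvx), rfl⟩
    have hnode : ((ρ, w) : Node r) ∈ nodes S.singletons S.intervals prog := by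
      refine mem_nodes.2 ⟨hρ, mem_words.2 ⟨by simp [hw, hN], fun o ho => ?_⟩⟩
      simp only [hw, List.mem_map, List.mem_range] at ho
      obtain ⟨x, hx, rfl⟩ := ho
      rcases hvx : v x with _ | y
      · simp
      · exact List.mem_cons_of_mem _ (List.mem_map_of_mem
          (S.toGrid_mem_gridPoints (hvF x hx y hvx) hcard))
    refine ⟨(ρ, w), mem_reached_of_enabled hnode ⟨?_, fun B hB => ?_⟩, rfl,
      (hatom _ (.inl rfl) _ hhead).symm⟩
    · rw [← none_mem_iff_of_diagram_eq (hatom _ (.inl rfl) _ hhead)]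
      simp
    · have hd := hatom B (.inr hB) _ (hbody B hB)
      by_cases hB0 : B.1 = none
      · refine .inl ⟨hB0, ?_⟩
        have hB1 := hder B hB
        rw [hB0] at hB1
        obtain ⟨x, y, hxy, hb⟩ := hB1.exists_lt hprog
        rw [← hd, hb]
        exact diagram_eq_ltTable hxy
      · obtain ⟨y, hy, hyP, hyd⟩ := ih B hB hB0
        exact .inr ⟨y, hy, hyP, hyd.trans hd⟩

/-! ### Soundness of the search -/

theorem isGridPoint_of_mem_assignments {w : Assignment}
    (hw : w ∈ assignments S.singletons S.intervals prog) {p : ℕ × ℕ} (hp : some p ∈ w) :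
    IsGridPoint S.singletons S.intervals p := by
  have := (mem_words.1 hw).2 _ hp
  simp only [List.mem_cons, reduceCtorEq, List.mem_map, Option.some.injEq, exists_eq_right,
    false_or] at this
  exact .of_mem_gridPoints this

theorem isGridPoint_of_mem_instTuple {w : Assignment}
    (hw : w ∈ assignments S.singletons S.intervals prog) {B : Atom r} {p : ℕ × ℕ}
    (hp : some p ∈ instTuple (fun i => S.level (c i)) w B) :
    IsGridPoint S.singletons S.intervals p := by
  obtain ⟨t, -, ht⟩ := List.mem_map.1 hp
  cases t with
  | inl x =>
    simp only [Term.eval, Option.join_eq_some_iff] at ht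
    exact S.isGridPoint_of_mem_assignments hw (List.mem_of_getElem? ht)
  | inr i =>
    simp only [Term.eval, Option.some.injEq] at ht
    subst ht
    exact .inl ⟨S.level_const i, rfl⟩

/-- The quantification over all `l` makes the induction work: a body atom only shares its diagram
with an earlier head, and its tuple in `Fill` is already fixed by the current assignment. -/
theorem derives_of_mem_reachedIn {n : ℕ} {x : Node r}
    (hx : x ∈ reachedIn (fun i => S.level (c i)) S.singletons S.intervals prog n)
    {l : List (Option (Fill S.singletons S.intervals))}
    (hl : instDiagram (fun i => S.level (c i)) x.2 x.1.1 =
      (Leveled.ofOrder Fill.level).diagram l) :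
    ∃ a, l = a.map some ∧ Derives S.fillConst prog x.1.1.1 a := by
  induction n generalizing x l with
  | zero => simp [reachedIn] at hx
  | succ n ih =>
    rw [reachedIn_succ, mem_enabledNodes, mem_nodes] at hx
    obtain ⟨ρ, w⟩ := x
    obtain ⟨⟨hρ, hw⟩, hnone, hbody⟩ := hx
    dsimp only at hρ hw hnone hbody hl
    obtain ⟨a, rfl⟩ := exists_eq_map_some fun h => hnone ((none_mem_iff_of_diagram_eq hl).2 h)
    -- Pair the head values with the prescribed tuple, then extend to the constants and to all
    -- values of `w`; the assignment `v` into `Fill` is read off from `T`.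
    obtain ⟨T, hsub, hT, hcov⟩ := (isPartialIso_of_diagram_eq hl).exists_superset
      S.not_mem_intervals
      ((List.finite_toSet ((instTuple (fun i => S.level (c i)) w ρ.1).zip (a.map some))).preimage
        (f := fun p : (ℕ × ℕ) × Fill S.singletons S.intervals => (some p.1, some p.2))
        fun p _ q _ h => by
          simpa [Prod.ext_iff] using h)
      (fun p hp => S.isGridPoint_of_mem_instTuple hw (List.of_mem_zip hp).1)
      (l := (List.ofFn fun i => (S.level (c i), 0)) ++ w.filterMap id) (by
        intro p hp
        rcases List.mem_append.1 hp with hp | hp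
        · obtain ⟨i, rfl⟩ := (List.mem_ofFn' _ _).1 hp
          exact .inl ⟨S.level_const i, rfl⟩
        · exact S.isGridPoint_of_mem_assignments hw (by simpa using hp))
    have hconst : ∀ i, ((S.level (c i), 0), S.fillConst i) ∈ T := by
      intro i
      obtain ⟨y, hy⟩ := hcov (S.level (c i), 0) (by simp)
      have hlev : S.level (c i) = y.level := hT.level _ hy
      -- The level of a constant has only one point in `Fill`, so the extension had no choice.
      have : y = S.fillConst i := by
        refine Fill.ext hlev.symm ?_
        rw [Fill.coord_eq_zero S.not_mem_intervals (hlev ▸ S.level_const i)]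
        rfl
      exact this ▸ hy
    have hv : ∀ x : ℕ, ∃ o : Option (Fill S.singletons S.intervals),
        Option.Rel (fun p y => (p, y) ∈ T) w[x]?.join o := by
      intro x
      rcases hwx : w[x]?.join with _ | p
      · exact ⟨none, .none⟩
      · rw [Option.join_eq_some_iff] at hwx
        obtain ⟨y, hy⟩ := hcov p (List.mem_append_right _
          (by simpa using List.mem_of_getElem? hwx))
        exact ⟨some y, .some hy⟩
    choose v hv using hv
    have hatom : ∀ B : Atom r, List.Forall₂ (Option.Rel fun p y => (p, y) ∈ T)
        (instTuple (fun i => S.level (c i)) w B) (B.2.map (Term.eval S.fillConst v)) :=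
      fun B => forall₂_eval (R := fun p y => (p, y) ∈ T) hconst fun x _ => hv x
    have hdiag : ∀ B : Atom r, instDiagram (fun i => S.level (c i)) w B =
        (Leveled.ofOrder Fill.level).diagram (B.2.map (Term.eval S.fillConst v)) :=
      fun B => hT.diagram_eq (hatom B)
    have hb : ∀ B ∈ ρ.2, ∃ b, Atom.Matches S.fillConst v B b ∧
        Derives S.fillConst prog B.1 b := by
      intro B hB
      rcases hbody B hB with ⟨hB0, htab⟩ | ⟨y, hy, hyB, hyd⟩
      · rw [hdiag B] at htab
        obtain ⟨y, z, hyz, h⟩ := exists_lt_of_diagram_eq_ltTable htab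
        refine ⟨[y, z], h, ?_⟩
        rw [hB0]
        exact .lt (by simpa [Leveled.ofOrder] using hyz)
      · obtain ⟨b, h, hder⟩ := ih hy (hyd.trans (hdiag B))
        exact ⟨b, h, hyB ▸ hder⟩
    choose! bs hbs hder using hb
    refine ⟨a, rfl, .rule hρ v bs ?_ hbs hder⟩
    have hlen := length_eq_of_diagram_eq hl
    have hH := hatom ρ.1
    -- The head under `v` is the prescribed tuple, since in each position `T` relates the same grid
    -- point to both entries.
    refine List.ext_getElem (hH.length_eq.symm.trans hlen) fun k h1 h2 => ?_
    have h3 : k < (instTuple (fun i => S.level (c i)) w ρ.1).length := hlen ▸ h2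
    have hrel := hH.get h3 h1
    simp only [List.get_eq_getElem] at hrel
    obtain ⟨p, hp⟩ := Option.ne_none_iff_exists'.1
      fun h => hnone (h ▸ List.getElem_mem h3)
    have hmem : (p, a[k]'(by simpa using h2)) ∈ T := by
      refine hsub (List.mem_iff_getElem.2 ⟨k, by simpa using ⟨h3, by simpa using h2⟩, ?_⟩)
      simp [hp]
    rw [hp] at hrel
    generalize (List.map (Term.eval S.fillConst v) ρ.1.2)[k] = o at hrel
    cases hrel with
    | some hy => simp [hT.right_unique hy hmem]

/-- The empty partial isomorphism extends to the head values, so the diagram is realized in `Fill`;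
the resulting derivation is then moved into `A`. -/
theorem exists_derives_of_mem_reached {x : Node r} (hx : x ∈ S.reached prog) :
    ∃ a, Derives c prog x.1.1.1 a := by
  have hx' : x ∈ enabledNodes (fun i => S.level (c i)) S.singletons S.intervals prog
      (S.reached prog) := by
    rw [reached, enabledNodes_reached]
    exact hx
  have hw := (mem_nodes.1 (mem_enabledNodes.1 hx').1).2
  set H := instTuple (fun i => S.level (c i)) x.2 x.1.1 with hH
  have hempty : IsPartialIso grid (.ofOrder Fill.level)
      (∅ : Set ((ℕ × ℕ) × Fill S.singletons S.intervals)) := ⟨by simp, by simp⟩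
  obtain ⟨T, -, hT, hcov⟩ := hempty.exists_superset S.not_mem_intervals Set.finite_empty (by simp)
    (l := H.filterMap id) fun p hp => S.isGridPoint_of_mem_instTuple hw (by simpa using hp)
  obtain ⟨l, hl⟩ : ∃ l, List.Forall₂ (Option.Rel fun p y => (p, y) ∈ T) H l := by
    have : ∀ o ∈ H, ∃ o', Option.Rel (fun p y => (p, y) ∈ T) o o' := by
      rintro (_ | p) hp
      · exact ⟨none, .none⟩
      · obtain ⟨y, hy⟩ := hcov p (by simpa using hp)
        exact ⟨some y, .some hy⟩
    choose! f hf using this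
    exact ⟨H.map f, List.forall₂_map_right_iff.2 (List.forall₂_same.2 hf)⟩
  obtain ⟨a, -, ha⟩ := S.derives_of_mem_reachedIn hx (hT.diagram_eq hl)
  obtain ⟨F, hF⟩ := ha.exists_finset (c := c)
  obtain ⟨f, hf, hc⟩ := S.exists_strictMonoOn F
  exact ⟨_, hF f hf hc⟩

theorem nonemptiness_iff (x : Program r × RelSym) :
    Nonemptiness c x ↔ Program.IsOver x.1 ∧ Program.IsIDB x.1 x.2 ∧
      ∃ y ∈ S.reached x.1, y.1.1.1 = x.2 := by
  obtain ⟨prog, P⟩ := x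
  refine and_congr_right fun hover => and_congr_right fun hidb => ⟨?_, ?_⟩
  · rintro ⟨a, ha⟩
    have hP : P ≠ none := by
      rintro rfl
      exact hover.2.1 hidb
    obtain ⟨y, hy, hyP, -⟩ := S.exists_mem_reached hover.2.1 (mem_result_iff.1 ha) hP
    exact ⟨y, hy, hyP⟩
  · rintro ⟨y, hy, rfl⟩
    obtain ⟨a, ha⟩ := S.exists_derives_of_mem_reached hy
    exact ⟨a, mem_result_iff.2 ha⟩

end Stratification

/-! ### The search is primitive recursive -/

section Primrec

variable {r : ℕ}

theorem primrec_evalGrid (lc : Fin r → ℕ) :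
    Primrec₂ fun (w : Assignment) (t : Term r) =>
      Term.eval (fun i => (lc i, 0)) (fun x => w[x]?.join) t := by
  have h1 : Primrec₂ fun (p : Assignment × Term r) (x : ℕ) => p.1[x]?.join :=
    (Primrec.option_bind (Primrec.list_getElem?.comp (Primrec.fst.comp Primrec.fst) Primrec.snd)
      Primrec.snd.to₂).of_eq fun p => by dsimp only; cases p.1.1[p.2]? <;> rfl
  have h2 : Primrec₂ fun (_ : Assignment × Term r) (i : Fin r) => some (lc i, 0) :=
    -- No effectivity of `lc` is needed, as its domain is finite.
    ((Primrec.dom_finite fun i : Fin r => some (lc i, 0)).comp Primrec.snd).to₂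
  exact (Primrec.sumCasesOn Primrec.snd h1 h2).of_eq fun ⟨w, t⟩ => by cases t <;> rfl

theorem primrec_instTuple (lc : Fin r → ℕ) : Primrec₂ (instTuple lc) :=
  Primrec.list_map (Primrec.snd.comp Primrec.snd)
    ((primrec_evalGrid lc).comp (Primrec.fst.comp Primrec.fst) Primrec.snd).to₂

theorem primrec_grid_lt : Primrec₂ grid.lt := by
  have : PrimrecRel fun p q : ℕ × ℕ => p.1 < q.1 ∨ p.1 = q.1 ∧ p.2 < q.2 := by
    have h1 : Primrec fun x : (ℕ × ℕ) × (ℕ × ℕ) => x.1.1 := Primrec.fst.comp Primrec.fst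
    have h2 : Primrec fun x : (ℕ × ℕ) × (ℕ × ℕ) => x.1.2 := Primrec.snd.comp Primrec.fst
    have h3 : Primrec fun x : (ℕ × ℕ) × (ℕ × ℕ) => x.2.1 := Primrec.fst.comp Primrec.snd
    have h4 : Primrec fun x : (ℕ × ℕ) × (ℕ × ℕ) => x.2.2 := Primrec.snd.comp Primrec.snd
    exact (Primrec.nat_lt.comp h1 h3).or ((Primrec.eq.comp h1 h3).and (Primrec.nat_lt.comp h2 h4))
  exact this.decide

theorem primrec_diagram : Primrec grid.diagram := by
  have hlt : Primrec₂ fun o o' : Option (ℕ × ℕ) =>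
      o.elim false fun x => o'.elim false fun y => grid.lt x y := by
    have h2 : Primrec₂ fun (p : Option (ℕ × ℕ) × Option (ℕ × ℕ)) (x : ℕ × ℕ) =>
        p.2.elim false fun y => grid.lt x y :=
      (Primrec.option_casesOn (Primrec.snd.comp Primrec.fst) (Primrec.const false)
        (primrec_grid_lt.comp (Primrec.snd.comp Primrec.fst) Primrec.snd).to₂).of_eq
        fun ⟨⟨_, o⟩, _⟩ => by cases o <;> rfl
    exact (Primrec.option_casesOn Primrec.fst (Primrec.const false) h2).of_eq
      fun ⟨o, _⟩ => by cases o <;> rfl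
  have hrow : Primrec₂ fun (l : List (Option (ℕ × ℕ))) (o : Option (ℕ × ℕ)) =>
      l.map fun o' => o.elim false fun x => o'.elim false fun y => grid.lt x y :=
    Primrec.list_map Primrec.fst (hlt.comp (Primrec.snd.comp Primrec.fst) Primrec.snd).to₂
  exact Primrec.pair (Primrec.list_map Primrec.id
    (Primrec.option_map Primrec.snd (Primrec.fst.comp Primrec.snd).to₂).to₂)
    (Primrec.list_map Primrec.id hrow)

theorem primrec_instDiagram (lc : Fin r → ℕ) : Primrec₂ (instDiagram lc) :=
  primrec_diagram.comp₂ (primrec_instTuple lc)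

theorem primrecRel_atomHolds (lc : Fin r → ℕ) : PrimrecRel (AtomHolds lc) := by
  have hfst : Primrec fun p : Atom r × Assignment × List (Node r) => p.1.1 :=
    Primrec.fst.comp Primrec.fst
  have hdiag : Primrec fun p : Atom r × Assignment × List (Node r) => instDiagram lc p.2.1 p.1 :=
    (primrec_instDiagram lc).comp (Primrec.fst.comp Primrec.snd) Primrec.fst
  have h1 : PrimrecPred fun p : Atom r × Assignment × List (Node r) =>
      p.1.1 = none ∧ (instDiagram lc p.2.1 p.1).2 = ltTable :=
    (Primrec.eq.comp hfst (Primrec.const none)).and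
      (Primrec.eq.comp (Primrec.snd.comp hdiag) (Primrec.const ltTable))
  have h2 : PrimrecRel fun (y : Node r) (p : Atom r × Assignment × List (Node r)) =>
      y.1.1.1 = p.1.1 ∧ instDiagram lc y.2 y.1.1 = instDiagram lc p.2.1 p.1 := by
    have h : Primrec fun y : Node r => y.1.1 := Primrec.fst.comp Primrec.fst
    exact (Primrec.eq.comp (Primrec.fst.comp (h.comp Primrec.fst)) (hfst.comp Primrec.snd)).and
      (Primrec.eq.comp
        ((primrec_instDiagram lc).comp (Primrec.snd.comp Primrec.fst) (h.comp Primrec.fst))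
        (hdiag.comp Primrec.snd))
  exact h1.or (h2.exists_mem_list.comp (Primrec.snd.comp Primrec.snd) Primrec.id)

theorem primrecRel_enabled (lc : Fin r → ℕ) : PrimrecRel (Enabled lc) := by
  have h1 : PrimrecPred fun p : Node r × List (Node r) => none ∉ instTuple lc p.1.2 p.1.1.1 := by
    have : PrimrecPred fun l : List (Option (ℕ × ℕ)) => ∀ o ∈ l, o ≠ none :=
      (Primrec.eq.comp Primrec.id (Primrec.const none)).not.forall_mem_list
    refine (this.comp ((primrec_instTuple lc).comp (Primrec.snd.comp Primrec.fst)
      (Primrec.fst.comp (Primrec.fst.comp Primrec.fst)))).of_eq fun p => ?_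
    exact ⟨fun h h' => h _ h' rfl, fun h o ho ho' => h (ho' ▸ ho)⟩
  exact h1.and ((primrecRel_atomHolds lc).forall_mem_list.comp
    (Primrec.snd.comp (Primrec.fst.comp Primrec.fst))
    (Primrec.pair (Primrec.snd.comp Primrec.fst) Primrec.snd))

theorem primrec_words {α : Type*} [Primcodable α] :
    Primrec₂ (words : List α → ℕ → List (List α)) := by
  have h : Primrec₂ fun (l : List α) (p : ℕ × List (List α)) =>
      p.2.flatMap fun w => l.map fun a => a :: w := by
    have hrow : Primrec₂ fun (q : List α × ℕ × List (List α)) (w : List α) =>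
        q.1.map fun a => a :: w :=
      Primrec.list_map (Primrec.fst.comp Primrec.fst)
        (Primrec.list_cons.comp Primrec.snd (Primrec.snd.comp Primrec.fst)).to₂
    exact Primrec.list_flatMap (Primrec.snd.comp Primrec.snd) hrow
  refine (Primrec.nat_rec (Primrec.const [[]]) h).of_eq fun l n => ?_
  induction n with
  | zero => rfl
  | succ n ih => simp only [words, ih]

theorem primrec_gridPoints (sg iv : List ℕ) : Primrec (gridPoints sg iv) := by
  have hrow : Primrec₂ fun N n : ℕ => (List.range N).map fun t => (n, t) :=
    Primrec.list_map (Primrec.list_range.comp Primrec.fst)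
      (Primrec.pair (Primrec.snd.comp Primrec.fst) Primrec.snd).to₂
  exact Primrec.list_append.comp (Primrec.const _)
    (Primrec.list_flatMap (Primrec.const iv) hrow)

theorem primrec_varBound : Primrec (varBound : Program r → ℕ) :=
  Primrec.succ.comp Primrec.encode

theorem primrec_assignments (sg iv : List ℕ) :
    Primrec (assignments sg iv : Program r → List Assignment) := by
  refine primrec_words.comp (Primrec.list_cons.comp (Primrec.const none) ?_) primrec_varBound
  exact Primrec.list_map ((primrec_gridPoints sg iv).comp primrec_varBound)
    (Primrec.option_some.comp Primrec.snd).to₂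

theorem primrec_nodes (sg iv : List ℕ) :
    Primrec (nodes sg iv : Program r → List (Node r)) :=
  Primrec.list_flatMap Primrec.id (Primrec.list_map
    ((primrec_assignments sg iv).comp Primrec.fst)
    (Primrec.pair (Primrec.snd.comp Primrec.fst) Primrec.snd).to₂).to₂

theorem primrec_reached (lc : Fin r → ℕ) (sg iv : List ℕ) :
    Primrec (reached lc sg iv : Program r → List (Node r)) := by
  classical
  have h : Primrec₂ (enabledNodes lc sg iv : Program r → List (Node r) → List (Node r)) :=
    ((primrecRel_enabled lc).listFilter.comp ((primrec_nodes sg iv).comp Primrec.fst)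
      Primrec.snd).of_eq fun p => by simp only [enabledNodes]
  exact Primrec.nat_iterate (Primrec.list_length.comp (primrec_nodes sg iv)) (Primrec.const []) h

/-! ### Syntactic conditions on programs -/

theorem primrec_arity : Primrec RelSym.arity :=
  (Primrec.option_casesOn Primrec.id (Primrec.const 2) (Primrec.snd.comp Primrec.snd).to₂).of_eq
    fun P => by rcases P with _ | ⟨_, _⟩ <;> rfl

theorem primrecPred_wellFormed : PrimrecPred (Atom.WellFormed : Atom r → Prop) :=
  Primrec.eq.comp (Primrec.list_length.comp Primrec.snd) (primrec_arity.comp Primrec.fst)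

theorem primrecRel_isIDB : PrimrecRel (Program.IsIDB : Program r → RelSym → Prop) := by
  have : PrimrecRel fun (ρ : Rule r) (P : RelSym) => ρ.1.1 = P :=
    Primrec.eq.comp (Primrec.fst.comp (Primrec.fst.comp Primrec.fst)) Primrec.snd
  exact this.exists_mem_list

theorem primrecPred_isOver : PrimrecPred (Program.IsOver : Program r → Prop) := by
  have h1 : PrimrecPred fun prog : Program r =>
      ∀ ρ ∈ prog, Atom.WellFormed ρ.1 ∧ ∀ B ∈ ρ.2, Atom.WellFormed B :=
    ((primrecPred_wellFormed.comp Primrec.fst).and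
      (primrecPred_wellFormed.forall_mem_list.comp Primrec.snd)).forall_mem_list
  have h2 : PrimrecPred fun prog : Program r => ¬ Program.IsIDB prog none :=
    (primrecRel_isIDB.comp Primrec.id (Primrec.const none)).not
  have h3 : PrimrecRel fun (B : Atom r) (prog : Program r) =>
      Program.IsIDB prog B.1 ∨ B.1 = none := by
    have hB : Primrec fun p : Atom r × Program r => p.1.1 := Primrec.fst.comp Primrec.fst
    exact (primrecRel_isIDB.comp Primrec.snd hB).or (Primrec.eq.comp hB (Primrec.const none))
  have h4 : PrimrecRel fun (ρ : Rule r) (prog : Program r) =>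
      ∀ B ∈ ρ.2, Program.IsIDB prog B.1 ∨ B.1 = none :=
    h3.forall_mem_list.comp (Primrec.snd.comp Primrec.fst) Primrec.snd
  have h5 : PrimrecPred fun prog : Program r =>
      ∀ ρ ∈ prog, ∀ B ∈ ρ.2, Program.IsIDB prog B.1 ∨ B.1 = none :=
    h4.forall_mem_list.comp Primrec.id Primrec.id
  refine (h1.and (h2.and h5)).of_eq fun prog => ?_
  simp only [Program.IsOver, or_iff_not_imp_left]

theorem primrecPred_reached (lc : Fin r → ℕ) (sg iv : List ℕ) :
    PrimrecPred fun x : Program r × RelSym => Program.IsOver x.1 ∧ Program.IsIDB x.1 x.2 ∧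
      ∃ y ∈ reached lc sg iv x.1, y.1.1.1 = x.2 := by
  have h : PrimrecRel fun (y : Node r) (P : RelSym) => y.1.1.1 = P :=
    Primrec.eq.comp (Primrec.fst.comp (Primrec.fst.comp (Primrec.fst.comp Primrec.fst))) Primrec.snd
  exact (primrecPred_isOver.comp Primrec.fst).and
    ((primrecRel_isIDB.comp Primrec.fst Primrec.snd).and
      (h.exists_mem_list.comp ((primrec_reached lc sg iv).comp Primrec.fst) Primrec.snd))

end Primrec

end Datalog

theorem mainTheorem6 {A : Type*} [LinearOrder A] {r : ℕ} (c : Fin r → A) :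
    ComputablePred (Datalog.Nonemptiness c) := by
  -- The stratification is merely known to exist; only its two finite lists and the levels of the
  -- constants enter the algorithm.
  obtain ⟨S⟩ := Datalog.nonempty_stratification c
  exact (Datalog.primrecPred_reached (fun i => S.level (c i)) S.singletons
    S.intervals).computablePred.of_eq fun x => (S.nonemptiness_iff x).symm
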